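/- Let $(\mathbb{T},+)$ be a finitely generated torsion-free abelian group. Write $H(P)=-\sum_a P(a)\log P(a)$ for the Shannon entropy of a finitely supported probability distribution $P$, and $H(Z)$ for the entropy of the distribution of a random variable $Z$. For probability distributions $P_X,P_Y$ on $\mathbb{T}$, let $\Pi(X,Y)$ be the set of all couplings of $P_X$ and $P_Y$, i.e. of all joint distributions on $\mathbb{T}\times\mathbb{T}$ whose marginals are $P_X$ and $P_Y$; in $\max_{\Pi(X,Y)}H(X\pm Y)$ the maximum is taken over all joint distributions of $(X,Y)$ in $\Pi(X,Y)$. For finitely supported $P_X,P_Y$ these maxima are attained. For any probability distributions $P_U,P_V,P_X,P_Y$ with finite support on $\mathbb{T}$, $$H(X)+H(Y)+\max_{\Pi(U,V)}H(U+V)\le \max_{\Pi(X,Y)}H(X-Y)+\max_{\Pi(X,U)}H(X-U)+\max_{\Pi(V,Y)}H(V-Y).$$ In particular (taking $U=Y$, $V=X$ in distribution), for any probability distributions $P_X,P_Y$ with finite support on $\mathbb{T}$, $$H(X)+H(Y)+\max_{\Pi(X,Y)}H(X+Y)\le 3\max_{\Pi(X,Y)}H(X-Y).$$ -/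

import Mathlib

/-- The Shannon entropy (in nats) of a discrete probability distribution `p`,
`H(p) = -∑ a, p a * log (p a)`. The sum is a finite one when `p` has finite support. -/
noncomputable def shannonEntropy {α : Type*} (p : PMF α) : ℝ :=
  ∑' a, Real.negMulLog (p a).toReal

/-- `Π(p, q)`: the set of all couplings of `p` and `q`, that is, of all joint distributions with
first marginal `p` and second marginal `q`. -/
def couplings {α β : Type*} (p : PMF α) (q : PMF β) : Set (PMF (α × β)) :=
  {r | r.map Prod.fst = p ∧ r.map Prod.snd = q}

/-- The set of all values `H(f(X, Y))`, where `(X, Y)` runs over the couplings of `p` and `q`. -/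
def couplingEntropies {α β γ : Type*} (f : α → β → γ) (p : PMF α) (q : PMF β) : Set ℝ :=
  {h | ∃ r ∈ couplings p q, h = shannonEntropy (r.map fun z => f z.1 z.2)}

/-- `max_{Π(p, q)} H(f(X, Y))`, defined as a supremum; wherever it is used, the supremum is
asserted to be a maximum (`IsGreatest`). -/
noncomputable def maxCouplingEntropy {α β γ : Type*} (f : α → β → γ) (p : PMF α) (q : PMF β) : ℝ :=
  sSup (couplingEntropies f p q)

/-- `max_{Π(X, Y)} H(X + Y)`, for `X` and `Y` distributed as `p` and `q`. -/
noncomputable def maxEntropyAdd {T : Type*} [AddCommGroup T] (p q : PMF T) : ℝ :=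
  maxCouplingEntropy (fun x y : T => x + y) p q

/-- `max_{Π(X, Y)} H(X - Y)`, for `X` and `Y` distributed as `p` and `q`. -/
noncomputable def maxEntropySub {T : Type*} [AddCommGroup T] (p q : PMF T) : ℝ :=
  maxCouplingEntropy (fun x y : T => x - y) p q

open Finset Real
open scoped ENNReal

/-! ### Finite sums for entropy, Gibbs' inequality, submodularity. -/

section Entropy

variable {α β γ : Type*}

/-! Take `X`, `Y` independent and let `(x, y)`, `(x', y')` be copies of `(X, Y)`, conditionally
independent given the common value `x - y = x' - y'`; their joint entropy is `2H(X) + 2H(Y) - H(X -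
Y)` (`exists_condIndep_copies`). Let `(u, v)` have any joint law with marginals `U`, `V`,
independent of the copies, and put `G = (x - u, v - y', x', y)`.

The sum `u + v` is a function of `(u, v)`, and also of `G`, since `(v - y') - (x - u) + x' + y = u +
v`. Moreover `(u, v)` and `G` together determine all six variables. Submodularity
(`shannonEntropy_submodular`) then gives, after cancelling `H(u, v)`, `2H(X) + 2H(Y) - H(X - Y) +
H(u + v) ≤ H(G) ≤ H(x - u) + H(v - y') + H(X) + H(Y)`. Each entropy of a difference is at most the
corresponding maximum, and `(u, v)` can be chosen to maximize `H(u + v)`: the maximum is attained by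
compactness. -/

theorem PMF.finite_support_map {p : PMF α} (hp : p.support.Finite) (f : α → β) :
    (p.map f).support.Finite := by
  rw [PMF.support_map]
  exact hp.image f

theorem PMF.sum_toReal_eq_one (p : PMF α) {s : Finset α} (hs : p.support ⊆ s) :
    ∑ a ∈ s, (p a).toReal = 1 := by
  rw [← ENNReal.toReal_sum fun a _ => p.apply_ne_top a, ← ENNReal.toReal_one, ← p.tsum_coe,
    tsum_eq_sum (s := s) fun a ha => by
      by_contra h
      exact ha (hs ((p.mem_support_iff a).2 h))]

theorem PMF.toReal_pos_of_mem_support {p : PMF α} {a : α} (ha : a ∈ p.support) :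
    0 < (p a).toReal :=
  ENNReal.toReal_pos ((p.mem_support_iff a).1 ha) (p.apply_ne_top a)

theorem PMF.le_map_apply (p : PMF α) (f : α → β) (a : α) : p a ≤ p.map f (f a) := by
  classical
  rw [PMF.map_apply]
  exact le_trans (by simp) (ENNReal.le_tsum a)

theorem PMF.map_apply_toReal [DecidableEq β] (p : PMF α) {s : Finset α} (hs : p.support ⊆ s)
    (f : α → β) (b : β) :
    (p.map f b).toReal = ∑ a ∈ s with f a = b, (p a).toReal := by
  classical
  rw [PMF.map_apply, tsum_eq_sum (s := s), ENNReal.toReal_sum, Finset.sum_filter]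
  · refine Finset.sum_congr rfl fun a _ => ?_
    by_cases h : f a = b
    · simp [h]
    · simp [h, Ne.symm h]
  · intro a _
    split_ifs
    exacts [p.apply_ne_top a, ENNReal.zero_ne_top]
  · intro a ha
    have : p a = 0 := by
      by_contra h
      exact ha (hs ((p.mem_support_iff a).2 h))
    simp [this]

theorem shannonEntropy_eq_sum {p : PMF α} {s : Finset α} (hs : p.support ⊆ s) :
    shannonEntropy p = ∑ a ∈ s, negMulLog (p a).toReal := by
  refine tsum_eq_sum fun a ha => ?_
  have : p a = 0 := by
    by_contra h
    exact ha (hs ((p.mem_support_iff a).2 h))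
  simp [this]

/-- The entropy of `f(Z)` is the expectation of `-log P(f(Z))`. -/
theorem shannonEntropy_map {p : PMF α} {s : Finset α} (hs : p.support ⊆ s) (f : α → β) :
    shannonEntropy (p.map f) = -∑ a ∈ s, (p a).toReal * log (p.map f (f a)).toReal := by
  classical
  have h : (p.map f).support ⊆ (s.image f : Finset β) := by
    rw [PMF.support_map, Finset.coe_image]
    exact Set.image_mono hs
  rw [shannonEntropy_eq_sum h, ← Finset.sum_neg_distrib,
    ← Finset.sum_fiberwise_of_maps_to (g := f) fun a ha => Finset.mem_image_of_mem f ha]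
  refine Finset.sum_congr rfl fun b _ => ?_
  rw [negMulLog, neg_mul, PMF.map_apply_toReal p hs f b, Finset.sum_mul, ← Finset.sum_neg_distrib]
  refine Finset.sum_congr rfl fun a ha => ?_
  rw [(Finset.mem_filter.1 ha).2, PMF.map_apply_toReal p hs f b]

theorem shannonEntropy_eq_neg_sum {p : PMF α} {s : Finset α} (hs : p.support ⊆ s) :
    shannonEntropy p = -∑ a ∈ s, (p a).toReal * log (p a).toReal := by
  simpa [PMF.map_id] using shannonEntropy_map hs id

theorem shannonEntropy_map_of_injective {p : PMF α} (hp : p.support.Finite) {f : α → β}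
    (hf : Function.Injective f) : shannonEntropy (p.map f) = shannonEntropy p := by
  classical
  have hs : p.support ⊆ hp.toFinset := by simp
  rw [shannonEntropy_map hs, shannonEntropy_eq_neg_sum hs]
  have h (a : α) : p.map f (f a) = p a := by
    rw [PMF.map_apply, tsum_eq_single a fun b hb => if_neg fun h => hb (hf h).symm, if_pos rfl]
  simp only [h]

/-- Gibbs' inequality. -/
theorem PMF.sum_mul_log_nonpos {p : PMF α} {s : Finset α} (hs : p.support ⊆ s) {g : α → ℝ}
    (hg : ∀ a ∈ p.support, 0 < g a) (h : ∑ a ∈ s, (p a).toReal * g a ≤ 1) :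
    ∑ a ∈ s, (p a).toReal * log (g a) ≤ 0 := by
  calc ∑ a ∈ s, (p a).toReal * log (g a)
      ≤ ∑ a ∈ s, ((p a).toReal * g a - (p a).toReal) := by
        refine Finset.sum_le_sum fun a _ => ?_
        by_cases ha : a ∈ p.support
        · nlinarith [log_le_sub_one_of_pos (hg a ha), ENNReal.toReal_nonneg (a := p a)]
        · have : p a = 0 := by simpa [PMF.mem_support_iff] using ha
          simp [this]
    _ ≤ 0 := by
        rw [Finset.sum_sub_distrib, p.sum_toReal_eq_one hs]
        linarith

/-- Submodularity of entropy: if `φ(X) = ψ(Y)` almost surely, then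
`H(X, Y) + H(φ(X)) ≤ H(X) + H(Y)`. -/
theorem shannonEntropy_submodular {r : PMF (α × β)} (hr : r.support.Finite) {φ : α → γ} {ψ : β → γ}
    (h : ∀ z ∈ r.support, φ z.1 = ψ z.2) :
    shannonEntropy r + shannonEntropy (r.map fun z => φ z.1) ≤
      shannonEntropy (r.map Prod.fst) + shannonEntropy (r.map Prod.snd) := by
  classical
  set s := hr.toFinset with hs_def
  have hs : r.support ⊆ s := by simp [hs_def]
  set p := r.map Prod.fst with hp
  set q := r.map Prod.snd with hq
  set t := r.map fun z => φ z.1 with ht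
  -- `φ` and `ψ` need only agree on atoms of positive mass, so the two laws are compared term by
  -- term.
  have htq : t = q.map ψ := by
    rw [hq, PMF.map_comp, ht, ← PMF.bind_pure_comp, ← PMF.bind_pure_comp]
    ext c
    simp only [PMF.bind_apply]
    refine tsum_congr fun z => ?_
    by_cases hz : z ∈ r.support
    · simp [h z hz]
    · have : r z = 0 := by simpa [PMF.mem_support_iff] using hz
      simp [this]
  have hpp : p.support ⊆ (s.image Prod.fst : Finset α) := by
    rw [hp, PMF.support_map, Finset.coe_image]
    exact Set.image_mono hs
  have hqq : q.support ⊆ (s.image Prod.snd : Finset β) := by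
    rw [hq, PMF.support_map, Finset.coe_image]
    exact Set.image_mono hs
  have pos (z : α × β) (hz : z ∈ r.support) : 0 < (r z).toReal ∧ 0 < (p z.1).toReal ∧
      0 < (q z.2).toReal ∧ 0 < (t (φ z.1)).toReal := by
    refine ⟨PMF.toReal_pos_of_mem_support hz, PMF.toReal_pos_of_mem_support ?_,
      PMF.toReal_pos_of_mem_support ?_, PMF.toReal_pos_of_mem_support ?_⟩
    all_goals
      rw [PMF.support_map]
      exact ⟨z, hz, rfl⟩
  -- The expected logarithm of `p q / (r t)` is `H(r) + H(t) - H(p) - H(q)`, so Gibbs' inequality is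
  -- exactly the claim.
  have key := PMF.sum_mul_log_nonpos hs
    (g := fun z => (p z.1).toReal * (q z.2).toReal / ((r z).toReal * (t (φ z.1)).toReal))
    (fun z hz => by
      obtain ⟨h1, h2, h3, h4⟩ := pos z hz
      positivity) ?_
  · rw [shannonEntropy_eq_neg_sum hs, hp, hq, ht, shannonEntropy_map hs, shannonEntropy_map hs,
      shannonEntropy_map hs, ← hp, ← hq, ← ht]
    have : ∑ z ∈ s, (r z).toReal * log ((p z.1).toReal * (q z.2).toReal /
          ((r z).toReal * (t (φ z.1)).toReal)) =
        ∑ z ∈ s, (r z).toReal * log (p z.1).toReal + ∑ z ∈ s, (r z).toReal * log (q z.2).toReal -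
        (∑ z ∈ s, (r z).toReal * log (r z).toReal +
          ∑ z ∈ s, (r z).toReal * log (t (φ z.1)).toReal) := by
      simp only [← Finset.sum_add_distrib, ← Finset.sum_sub_distrib]
      refine Finset.sum_congr rfl fun z hz => ?_
      obtain ⟨h1, h2, h3, h4⟩ := pos z (by simpa [hs_def] using hz)
      rw [log_div (by positivity) (by positivity), log_mul h2.ne' h3.ne', log_mul h1.ne' h4.ne']
      ring
    linarith
  -- After enlarging the sum to a full product, summing `q` over the fibre `ψ b = φ a` gives `t (φ
  -- a)`, which cancels the denominator.
  · calc ∑ z ∈ s, (r z).toReal *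
          ((p z.1).toReal * (q z.2).toReal / ((r z).toReal * (t (φ z.1)).toReal))
        = ∑ z ∈ s, (p z.1).toReal / (t (φ z.1)).toReal *
            (if ψ z.2 = φ z.1 then (q z.2).toReal else 0) := by
          refine Finset.sum_congr rfl fun z hz => ?_
          have hz' : z ∈ r.support := by simpa [hs_def] using hz
          obtain ⟨h1, h2, h3, h4⟩ := pos z hz'
          rw [if_pos (h z hz').symm]
          field_simp
      _ ≤ ∑ z ∈ s.image Prod.fst ×ˢ s.image Prod.snd, (p z.1).toReal / (t (φ z.1)).toReal *
            (if ψ z.2 = φ z.1 then (q z.2).toReal else 0) := by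
          refine Finset.sum_le_sum_of_subset_of_nonneg (fun z hz => Finset.mem_product.2
            ⟨Finset.mem_image_of_mem _ hz, Finset.mem_image_of_mem _ hz⟩) fun z _ _ => ?_
          split_ifs <;> positivity
      _ = ∑ a ∈ s.image Prod.fst, (p a).toReal / (t (φ a)).toReal * (t (φ a)).toReal := by
          rw [Finset.sum_product]
          refine Finset.sum_congr rfl fun a _ => ?_
          dsimp only
          rw [← Finset.mul_sum, ← Finset.sum_filter]
          congr 1
          rw [htq]
          exact (PMF.map_apply_toReal q hqq ψ (φ a)).symm
      _ ≤ ∑ a ∈ s.image Prod.fst, (p a).toReal :=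
          Finset.sum_le_sum fun a _ => by
            rcases eq_or_ne (t (φ a)).toReal 0 with h0 | h0
            · simp [h0]
            · rw [div_mul_cancel₀ _ h0]
      _ = 1 := p.sum_toReal_eq_one hpp

theorem shannonEntropy_map_const (p : PMF α) (c : β) :
    shannonEntropy (p.map fun _ => c) = 0 := by
  rw [shannonEntropy, show (p.map fun _ => c) = PMF.pure c from PMF.map_const p c]
  rw [tsum_eq_single c fun b hb => by simp [hb]]
  simp

/-- Subadditivity of entropy. -/
theorem shannonEntropy_le_add {r : PMF (α × β)} (hr : r.support.Finite) :
    shannonEntropy r ≤ shannonEntropy (r.map Prod.fst) + shannonEntropy (r.map Prod.snd) := by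
  have := shannonEntropy_submodular hr (φ := fun _ => ()) (ψ := fun _ => ()) fun _ _ => rfl
  rwa [shannonEntropy_map_const, add_zero] at this

end Entropy

/-! ### Independent and conditionally independent couplings. -/

section Product

variable {α β γ : Type*}

/-- The joint distribution of independent random variables with distributions `p` and `q`. -/
noncomputable def PMF.indep (p : PMF α) (q : PMF β) : PMF (α × β) :=
  p.bind fun a => q.map fun b => (a, b)

theorem PMF.indep_apply (p : PMF α) (q : PMF β) (z : α × β) : p.indep q z = p z.1 * q z.2 := by
  classical
  obtain ⟨a, b⟩ := z
  rw [PMF.indep, PMF.bind_apply, tsum_eq_single a]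
  · rw [PMF.map_apply, tsum_eq_single b]
    · simp
    · intro b' hb
      simp [Ne.symm hb]
  · intro a' ha
    simp [PMF.map_apply, Ne.symm ha]

theorem PMF.map_fst_indep (p : PMF α) (q : PMF β) : (p.indep q).map Prod.fst = p := by
  rw [PMF.indep, PMF.map_bind]
  simp only [PMF.map_comp, Function.comp_def]
  exact (congrArg p.bind (funext fun a => PMF.map_const q a)).trans (PMF.bind_pure p)

theorem PMF.map_snd_indep (p : PMF α) (q : PMF β) : (p.indep q).map Prod.snd = q := by
  rw [PMF.indep, PMF.map_bind]
  simp only [PMF.map_comp, Function.comp_def]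
  exact (PMF.bind_const p _).trans (PMF.map_id q)

theorem PMF.support_indep (p : PMF α) (q : PMF β) :
    (p.indep q).support = p.support ×ˢ q.support := by
  ext z
  simp [PMF.mem_support_iff, PMF.indep_apply]

theorem shannonEntropy_indep {p : PMF α} {q : PMF β} (hp : p.support.Finite)
    (hq : q.support.Finite) :
    shannonEntropy (p.indep q) = shannonEntropy p + shannonEntropy q := by
  have hs : (p.indep q).support ⊆ (hp.toFinset ×ˢ hq.toFinset : Finset (α × β)) := by
    simp [PMF.support_indep]
  have h1 := shannonEntropy_map hs Prod.fst
  have h2 := shannonEntropy_map hs Prod.snd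
  rw [PMF.map_fst_indep] at h1
  rw [PMF.map_snd_indep] at h2
  rw [h1, h2, shannonEntropy_eq_neg_sum hs, ← neg_add, ← Finset.sum_add_distrib]
  congr 1
  refine Finset.sum_congr rfl fun z hz => ?_
  simp only [Finset.mem_product, Set.Finite.mem_toFinset] at hz
  rw [PMF.indep_apply, ENNReal.toReal_mul, log_mul (PMF.toReal_pos_of_mem_support hz.1).ne'
    (PMF.toReal_pos_of_mem_support hz.2).ne']
  ring

theorem couplings_map_swap {p : PMF α} {q : PMF β} {r : PMF (α × β)} (hr : r ∈ couplings p q) :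
    r.map Prod.swap ∈ couplings q p := by
  refine ⟨?_, ?_⟩ <;> rw [PMF.map_comp]
  exacts [hr.2, hr.1]

/-- The conditionally independent coupling of two copies of `p` relative to `f`. -/
theorem exists_condIndep_copies {p : PMF α} (hp : p.support.Finite) (f : α → γ) :
    ∃ r ∈ couplings p p, (∀ z ∈ r.support, f z.1 = f z.2) ∧ r.support.Finite ∧
      shannonEntropy r = 2 * shannonEntropy p - shannonEntropy (p.map f) := by
  classical
  have hfib (a : α) : ∑' b, (if f a = f b then p b else 0) = p.map f (f a) := by
    rw [PMF.map_apply]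
  have hmarg (a : α) :
      ∑' b, (if f a = f b then p a * p b / p.map f (f a) else 0) = p a := by
    by_cases ha : p a = 0
    · simp [ha]
    have hne : p.map f (f a) ≠ 0 := fun h => ha (le_zero_iff.1 (h ▸ p.le_map_apply f a))
    calc ∑' b, (if f a = f b then p a * p b / p.map f (f a) else 0)
        = ∑' b, p a / p.map f (f a) * (if f a = f b then p b else 0) := by
          refine tsum_congr fun b => ?_
          split_ifs
          · rw [ENNReal.mul_div_right_comm]
          · simp
      _ = p a := by
          rw [ENNReal.tsum_mul_left, hfib, ENNReal.div_mul_cancel hne (PMF.apply_ne_top _ _)]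
  have hsymm (a b : α) : (if f a = f b then p a * p b / p.map f (f a) else 0) =
      if f b = f a then p b * p a / p.map f (f b) else 0 := by
    by_cases h : f a = f b
    · rw [if_pos h, if_pos h.symm, h, mul_comm]
    · rw [if_neg h, if_neg (Ne.symm h)]
  -- Given the value of `f`, the two coordinates are drawn independently from the conditional law.
  -- Where the denominator vanishes so does the numerator, and `0 / 0 = 0` is the right mass.
  let r : PMF (α × α) :=
    ⟨fun z => if f z.1 = f z.2 then p z.1 * p z.2 / p.map f (f z.1) else 0, by
      rw [ENNReal.summable.hasSum_iff, ENNReal.tsum_prod']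
      simp only [hmarg, p.tsum_coe]⟩
  have hr (z : α × α) :
      r z = if f z.1 = f z.2 then p z.1 * p z.2 / p.map f (f z.1) else 0 := rfl
  have h1 : r.map Prod.fst = p := by
    ext a
    rw [PMF.map_apply, ENNReal.tsum_prod', tsum_eq_single a fun b hb => by simp [Ne.symm hb]]
    simpa [hr] using hmarg a
  have h2 : r.map Prod.snd = p := by
    ext a
    rw [PMF.map_apply, ENNReal.tsum_prod', ENNReal.tsum_comm,
      tsum_eq_single a fun b hb => by simp [Ne.symm hb]]
    simp only [if_true, hr]
    exact (tsum_congr fun b => hsymm b a).trans (hmarg a)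
  have hmem (z : α × α) (hz : z ∈ r.support) :
      f z.1 = f z.2 ∧ z.1 ∈ p.support ∧ z.2 ∈ p.support := by
    rw [PMF.mem_support_iff, hr] at hz
    refine ⟨by_contra fun h => hz (if_neg h), ?_, ?_⟩ <;>
    · rw [PMF.mem_support_iff]
      intro h
      simp [h] at hz
  have hs : r.support ⊆ (hp.toFinset ×ˢ hp.toFinset : Finset (α × α)) := fun z hz => by
    simpa using (hmem z hz).2
  refine ⟨r, ⟨h1, h2⟩, fun z hz => (hmem z hz).1, (Finset.finite_toSet _).subset hs, ?_⟩
  have e1 := shannonEntropy_map hs Prod.fst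
  have e2 := shannonEntropy_map hs Prod.snd
  have e3 := shannonEntropy_map hs fun z => f z.1
  rw [h1] at e1
  rw [h2] at e2
  have h3 : (r.map fun z => f z.1) = p.map f := by
    conv_rhs => rw [← h1, PMF.map_comp]
    rfl
  rw [h3] at e3
  -- On the support the logarithm of the mass splits into two marginal terms minus the term of the
  -- common value.
  have : ∑ z ∈ hp.toFinset ×ˢ hp.toFinset, (r z).toReal * log (r z).toReal =
      ∑ z ∈ hp.toFinset ×ˢ hp.toFinset, (r z).toReal * log (p z.1).toReal +
      ∑ z ∈ hp.toFinset ×ˢ hp.toFinset, (r z).toReal * log (p z.2).toReal -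
      ∑ z ∈ hp.toFinset ×ˢ hp.toFinset, (r z).toReal * log (p.map f (f z.1)).toReal := by
    simp only [← Finset.sum_add_distrib, ← Finset.sum_sub_distrib]
    refine Finset.sum_congr rfl fun z _ => ?_
    by_cases hz : z ∈ r.support
    · obtain ⟨hz0, hz1, hz2⟩ := hmem z hz
      have hz3 : f z.1 ∈ (p.map f).support := by
        rw [PMF.support_map]
        exact ⟨_, hz1, rfl⟩
      have i1 := PMF.toReal_pos_of_mem_support hz1
      have i2 := PMF.toReal_pos_of_mem_support hz2
      have i3 := PMF.toReal_pos_of_mem_support hz3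
      have : log (r z).toReal =
          log (p z.1).toReal + log (p z.2).toReal - log (p.map f (f z.1)).toReal := by
        rw [hr, if_pos hz0, ENNReal.toReal_div, ENNReal.toReal_mul,
          log_div (by positivity) i3.ne', log_mul i1.ne' i2.ne']
      rw [this]
      ring
    · have : r z = 0 := by simpa [PMF.mem_support_iff] using hz
      simp [this]
  rw [shannonEntropy_eq_neg_sum hs, this]
  linarith

end Product

/-! ### Attainment of the maximum, by compactness. -/

section Maximum

variable {α β γ : Type*}

theorem couplings_support_subset {p : PMF α} {q : PMF β} {r : PMF (α × β)}
    (hr : r ∈ couplings p q) : r.support ⊆ p.support ×ˢ q.support := by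
  intro z hz
  refine ⟨?_, ?_⟩
  · rw [← hr.1, PMF.support_map]
    exact ⟨z, hz, rfl⟩
  · rw [← hr.2, PMF.support_map]
    exact ⟨z, hz, rfl⟩

theorem couplings_finite_support {p : PMF α} {q : PMF β} (hp : p.support.Finite)
    (hq : q.support.Finite) {r : PMF (α × β)} (hr : r ∈ couplings p q) : r.support.Finite :=
  (hp.prod hq).subset (couplings_support_subset hr)

theorem PMF.ext_toReal {p q : PMF α} (h : ∀ a, (p a).toReal = (q a).toReal) : p = q :=
  PMF.ext fun a => (ENNReal.toReal_eq_toReal_iff' (p.apply_ne_top a) (q.apply_ne_top a)).1 (h a)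

/-- The maximum of `H(f(X, Y))` over all couplings is attained. -/
theorem isGreatest_maxCouplingEntropy {p : PMF α} {q : PMF β} (hp : p.support.Finite)
    (hq : q.support.Finite) (f : α → β → γ) :
    IsGreatest (couplingEntropies f p q) (maxCouplingEntropy f p q) := by
  classical
  let s : Finset (α × β) := hp.toFinset ×ˢ hq.toFinset
  let F : α × β → γ := fun z => f z.1 z.2
  let Φ : (α × β → ℝ) → ℝ := fun w => ∑ c ∈ s.image F, negMulLog (∑ z ∈ s with F z = c, w z)
  -- The couplings as real weight functions. The index type may be infinite, so compactness comes
  -- from Tychonoff for the cube, cut down by closed linear conditions.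
  let K : Set (α × β → ℝ) := Set.pi Set.univ (fun _ => Set.Icc 0 1) ∩
    ({w | ∀ z ∉ s, w z = 0} ∩ ({w | ∑ z ∈ s, w z = 1} ∩
      ({w | ∀ a, ∑ z ∈ s with z.1 = a, w z = (p a).toReal} ∩
        {w | ∀ b, ∑ z ∈ s with z.2 = b, w z = (q b).toReal})))
  have hK : IsCompact K := by
    refine (isCompact_univ_pi fun _ => isCompact_Icc).inter_right (IsClosed.inter ?_
      (IsClosed.inter ?_ (IsClosed.inter ?_ ?_)))
    · simp only [Set.ofPred_forall]
      exact isClosed_iInter fun z => isClosed_iInter fun _ =>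
        isClosed_eq (continuous_apply z) continuous_const
    · exact isClosed_eq (by fun_prop) continuous_const
    · simp only [Set.ofPred_forall]
      exact isClosed_iInter fun a => isClosed_eq (by fun_prop) continuous_const
    · simp only [Set.ofPred_forall]
      exact isClosed_iInter fun a => isClosed_eq (by fun_prop) continuous_const
  have hΦ : Continuous Φ :=
    continuous_finsetSum _ fun c _ => continuous_negMulLog.comp (by fun_prop)
  have hsub {r : PMF (α × β)} (hr : r ∈ couplings p q) : r.support ⊆ s := fun z hz => by
    simpa [s] using couplings_support_subset hr hz
  have hent {r : PMF (α × β)} (hr : r.support ⊆ s) :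
      shannonEntropy (r.map F) = Φ fun z => (r z).toReal := by
    have h : (r.map F).support ⊆ (s.image F : Finset γ) := by
      rw [PMF.support_map, Finset.coe_image]
      exact Set.image_mono hr
    rw [shannonEntropy_eq_sum h]
    exact Finset.sum_congr rfl fun c _ => by rw [PMF.map_apply_toReal r hr]
  -- Couplings and points of `K` correspond through `ENNReal.toReal` and `ENNReal.ofReal`.
  have himage : couplingEntropies f p q = Φ '' K := by
    ext h
    constructor
    · rintro ⟨r, hr, rfl⟩
      have hrs := hsub hr
      refine ⟨fun z => (r z).toReal, ⟨fun z _ => ⟨ENNReal.toReal_nonneg, ?_⟩, fun z hz => ?_,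
        r.sum_toReal_eq_one hrs, fun a => ?_, fun b => ?_⟩, (hent hrs).symm⟩
      · exact ENNReal.toReal_le_of_le_ofReal zero_le_one (by simpa using r.coe_le_one z)
      · have : r z = 0 := by
          by_contra h
          exact hz (hrs ((r.mem_support_iff z).2 h))
        simp [this]
      · exact (PMF.map_apply_toReal r hrs _ _).symm.trans (by rw [hr.1])
      · exact (PMF.map_apply_toReal r hrs _ _).symm.trans (by rw [hr.2])
    · rintro ⟨w, ⟨hw, hw0, hw1, hwp, hwq⟩, rfl⟩
      have hnn (z : α × β) : 0 ≤ w z := (hw z trivial).1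
      let r : PMF (α × β) := PMF.ofFinset (fun z => ENNReal.ofReal (w z)) s
        (by rw [← ENNReal.ofReal_sum_of_nonneg fun z _ => hnn z, hw1, ENNReal.ofReal_one])
        fun z hz => by rw [hw0 z hz, ENNReal.ofReal_zero]
      have hrw (z : α × β) : (r z).toReal = w z := ENNReal.toReal_ofReal (hnn z)
      have hrs : r.support ⊆ s := fun z hz => by
        by_contra h
        refine (PMF.toReal_pos_of_mem_support hz).ne' ?_
        rw [hrw, hw0 z h]
      refine ⟨r, ⟨PMF.ext_toReal fun a => ?_, PMF.ext_toReal fun b => ?_⟩, ?_⟩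
      · rw [PMF.map_apply_toReal r hrs, ← hwp a]
        simp only [hrw]
      · rw [PMF.map_apply_toReal r hrs, ← hwq b]
        simp only [hrw]
      · rw [hent hrs]
        simp only [hrw]
  have hne : (couplingEntropies f p q).Nonempty :=
    ⟨_, p.indep q, ⟨p.map_fst_indep q, p.map_snd_indep q⟩, rfl⟩
  obtain ⟨m, hm⟩ := (himage ▸ hK.image hΦ : IsCompact (couplingEntropies f p q)).exists_isGreatest
    hne
  rw [maxCouplingEntropy, hm.csSup_eq]
  exact hm

theorem shannonEntropy_le_maxCouplingEntropy {p : PMF α} {q : PMF β} (hp : p.support.Finite)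
    (hq : q.support.Finite) (f : α → β → γ) {r : PMF (α × β)} (hr : r ∈ couplings p q) :
    shannonEntropy (r.map fun z => f z.1 z.2) ≤ maxCouplingEntropy f p q :=
  (isGreatest_maxCouplingEntropy hp hq f).2 ⟨r, hr, rfl⟩

end Maximum

/-! ### The sum-difference inequality. -/

section Group

variable {T : Type*} [AddCommGroup T]

/-- The sum-difference inequality for an arbitrary joint distribution `w` of `U` and `V`. -/
theorem shannonEntropy_add_le_maxEntropySub {U V X Y : PMF T} (hU : U.support.Finite)
    (hV : V.support.Finite) (hX : X.support.Finite) (hY : Y.support.Finite) {w : PMF (T × T)}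
    (hw : w ∈ couplings U V) :
    shannonEntropy X + shannonEntropy Y + shannonEntropy (w.map fun z => z.1 + z.2) ≤
      maxEntropySub X Y + maxEntropySub X U + maxEntropySub V Y := by
  have hwf := couplings_finite_support hU hV hw
  have hXYf : (X.indep Y).support.Finite := by
    rw [PMF.support_indep]
    exact hX.prod hY
  obtain ⟨r, hr, hrd, hrf, hre⟩ := exists_condIndep_copies hXYf fun z : T × T => z.1 - z.2
  rw [shannonEntropy_indep hX hY] at hre
  set μ := r.indep w with hμ
  have hμf : μ.support.Finite := by
    rw [hμ, PMF.support_indep]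
    exact hrf.prod hwf
  have hμe : shannonEntropy μ = shannonEntropy r + shannonEntropy w := shannonEntropy_indep hrf hwf
  -- A point is `(((x, y), (x', y')), (u, v))`, and its image is `((x - u, v - y'), (x', y))`.
  let g : ((T × T) × (T × T)) × (T × T) → (T × T) × (T × T) := fun z =>
    ((z.1.1.1 - z.2.1, z.2.2 - z.1.2.2), (z.1.2.1, z.1.1.2))
  -- The only coordinates not listed outright are `x` and `y'`, recovered from `x - u` and `v - y'`.
  have hinj : Function.Injective fun z => (z.2, g z) := by
    rintro ⟨⟨⟨x, y⟩, x', y'⟩, u, v⟩ ⟨⟨⟨a, b⟩, a', b'⟩, c, d⟩ h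
    simp only [g, Prod.mk.injEq] at h ⊢
    obtain ⟨⟨rfl, rfl⟩, ⟨h1, h2⟩, rfl, rfl⟩ := h
    simpa using And.intro h1 h2
  -- `ψ` evaluates to `u + v + (x' - y') - (x - y)`, and the last two terms cancel on the support.
  have hsub := shannonEntropy_submodular (PMF.finite_support_map hμf fun z => (z.2, g z))
    (φ := fun z : T × T => z.1 + z.2)
    (ψ := fun z : (T × T) × (T × T) => z.1.2 - z.1.1 + z.2.1 + z.2.2) (by
      intro z hz
      rw [PMF.support_map] at hz
      obtain ⟨⟨⟨⟨x, y⟩, x', y'⟩, u, v⟩, hz, rfl⟩ := hz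
      rw [hμ, PMF.support_indep] at hz
      have h : x - y = x' - y' := hrd _ hz.1
      obtain rfl : x = x' - y' + y := by rw [← h]; abel
      simp only [g]
      abel)
  rw [shannonEntropy_map_of_injective hμf hinj] at hsub
  simp only [PMF.map_comp, Function.comp_def] at hsub
  have e1 : (μ.map fun z => z.2) = w := PMF.map_snd_indep r w
  have e2 : (μ.map fun z => z.2.1 + z.2.2) = w.map fun z => z.1 + z.2 := by
    conv_rhs => rw [← e1, PMF.map_comp]
    rfl
  rw [e1, e2] at hsub
  have s1 := shannonEntropy_le_add (PMF.finite_support_map hμf g)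
  have s2 := shannonEntropy_le_add
    (PMF.finite_support_map hμf fun z => (g z).1)
  have s3 := shannonEntropy_le_add
    (PMF.finite_support_map hμf fun z => (g z).2)
  simp only [PMF.map_comp, Function.comp_def] at s1 s2 s3
  have m1 : (μ.map fun z => z.1) = r := PMF.map_fst_indep r w
  have m2 {S : Type _} (k : (T × T) × (T × T) → S) : (μ.map fun z => k z.1) = r.map k := by
    rw [← m1, PMF.map_comp]
    rfl
  have m3 {S : Type _} (k : T × T → S) : (μ.map fun z => k z.2) = w.map k := by
    rw [← e1, PMF.map_comp]
    rfl
  have n1 {S : Type _} (k : T × T → S) : (r.map fun z => k z.1) = (X.indep Y).map k := by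
    rw [← hr.1, PMF.map_comp]
    rfl
  have n2 {S : Type _} (k : T × T → S) : (r.map fun z => k z.2) = (X.indep Y).map k := by
    rw [← hr.2, PMF.map_comp]
    rfl
  have t1 : (μ.map fun z => (g z).2.1) = X :=
    (m2 fun z => z.2.1).trans ((n2 Prod.fst).trans (X.map_fst_indep Y))
  have t2 : (μ.map fun z => (g z).2.2) = Y :=
    (m2 fun z => z.1.2).trans ((n1 Prod.snd).trans (X.map_snd_indep Y))
  have c1 : (μ.map fun z => (z.1.1.1, z.2.1)) ∈ couplings X U := by
    refine ⟨?_, ?_⟩ <;> rw [PMF.map_comp]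
    · exact (m2 fun z => z.1.1).trans ((n1 Prod.fst).trans (X.map_fst_indep Y))
    · exact (m3 Prod.fst).trans hw.1
  have c2 : (μ.map fun z => (z.2.2, z.1.2.2)) ∈ couplings V Y := by
    refine ⟨?_, ?_⟩ <;> rw [PMF.map_comp]
    · exact (m3 Prod.snd).trans hw.2
    · exact (m2 fun z => z.2.2).trans ((n2 Prod.snd).trans (X.map_snd_indep Y))
  have u1 := shannonEntropy_le_maxCouplingEntropy hX hU (fun x y : T => x - y) c1
  have u2 := shannonEntropy_le_maxCouplingEntropy hV hY (fun x y : T => x - y) c2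
  -- The independent coupling bounds the `H(X - Y)` subtracted in `hre`.
  have u3 := shannonEntropy_le_maxCouplingEntropy hX hY (fun x y : T => x - y)
    ⟨X.map_fst_indep Y, X.map_snd_indep Y⟩
  simp only [PMF.map_comp, Function.comp_def] at u1 u2
  rw [t1, t2] at s3
  simp only [g] at s1 s2 s3 hsub
  unfold maxEntropySub
  linarith

end Group

theorem mainTheorem9 {T : Type*} [AddCommGroup T] [AddGroup.FG T] [IsAddTorsionFree T] :
    -- the maxima over couplings exist
    (∀ P Q : PMF T, P.support.Finite → Q.support.Finite →
      IsGreatest (couplingEntropies (fun x y : T => x + y) P Q) (maxEntropyAdd P Q) ∧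
      IsGreatest (couplingEntropies (fun x y : T => x - y) P Q) (maxEntropySub P Q)) ∧
    -- the inequality for four distributions
    (∀ U V X Y : PMF T, U.support.Finite → V.support.Finite →
      X.support.Finite → Y.support.Finite →
      shannonEntropy X + shannonEntropy Y + maxEntropyAdd U V ≤
        maxEntropySub X Y + maxEntropySub X U + maxEntropySub V Y) ∧
    -- the particular case of two distributions
    (∀ X Y : PMF T, X.support.Finite → Y.support.Finite →
      shannonEntropy X + shannonEntropy Y + maxEntropyAdd X Y ≤ 3 * maxEntropySub X Y) := by
  have main (U V X Y : PMF T) (hU : U.support.Finite) (hV : V.support.Finite)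
      (hX : X.support.Finite) (hY : Y.support.Finite) :
      shannonEntropy X + shannonEntropy Y + maxEntropyAdd U V ≤
        maxEntropySub X Y + maxEntropySub X U + maxEntropySub V Y := by
    obtain ⟨w, hw, h⟩ := (isGreatest_maxCouplingEntropy hU hV fun x y : T => x + y).1
    rw [maxEntropyAdd, h]
    exact shannonEntropy_add_le_maxEntropySub hU hV hX hY hw
  refine ⟨fun P Q hP hQ => ⟨isGreatest_maxCouplingEntropy hP hQ _,
    isGreatest_maxCouplingEntropy hP hQ _⟩, main, fun X Y hX hY => ?_⟩
  obtain ⟨w, hw, h⟩ := (isGreatest_maxCouplingEntropy hX hY fun x y : T => x + y).1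
  -- With `U = Y` and `V = X` all three terms on the right coincide; swapping the maximizing
  -- coupling does not change the law of the sum.
  have := shannonEntropy_add_le_maxEntropySub hY hX hX hY (couplings_map_swap hw)
  rw [PMF.map_comp, show ((fun z : T × T => z.1 + z.2) ∘ Prod.swap) = fun z => z.1 + z.2 from
    funext fun z => add_comm _ _] at this
  rw [maxEntropyAdd, h]
  linarith
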